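/- For $r\ge 1$ put $\delta_r:=3\cdot 4^{r-1}$ and $\delta'_r:=(3r+1)\cdot 4^{r-1}$. Define finite sets $S_{k,l}\subset\mathbb Z^2$ recursively: $S_{k,l}:=\{(0,0)\}$ if $k\le 2$ or $l\le 2$, and otherwise \[ S_{k,l}:=S_{k-1,l}\,\cup\,\{(x+\delta_r,\;y+\delta'_r):(x,y)\in S_{k,l-1}\},\qquad r:=k+l-1. \] Let $t\ge 1$ be an integer. For integers $i\ge 0$ put $v_i:=(3(t-i),-3i)$, and let $w_0:=(0,0)$, $w_{i+1}:=w_i+v_i$ for $0\le i\le t-3$. Let $D_i$ be the unit square with lower left corner $w_i$, scaled by the factor $(t+1)4^{t+1}$ about the origin, so that its lower left corner is $q_i:=(t+1)4^{t+1}\,w_i$. Let \[ S_t:=\bigcup_{i=0}^{t-2}\{\,p+q_i : p\in S_{t-i,\,i+2}\,\} \] (so $S_1=\emptyset$). A convex $k$-gon of $S_t$ is the convex hull of a finite set of points of the plane that has exactly $k$ vertices (extreme points), all of which belong to $S_t$; the degenerate cases $k\le 2$ are allowed. Theorem. For every integer $t\ge 1$, every convex $k$-gon of $S_t$ has at most $t-1$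 vertices, that is, $k\le t-1$. -/

import Mathlib

/-- The horizontal displacement `δ_r = 3 · 4^(r-1)` (used for `r ≥ 1`). -/
def deltaX (r : ℕ) : ℤ := 3 * 4 ^ (r - 1)

/-- The vertical displacement `δ'_r = (3 r + 1) · 4^(r-1)` (used for `r ≥ 1`). -/
def deltaY (r : ℕ) : ℤ := (3 * (r : ℤ) + 1) * 4 ^ (r - 1)

/-- The set `S_{k,l}`: a single point if `k ≤ 2` or `l ≤ 2`, and otherwise the union of
`S_{k-1,l}` and of the translate of `S_{k,l-1}` by `(δ_r, δ'_r)`, where `r = k + l - 1`. -/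
def blockSet (k l : ℕ) : Finset (ℤ × ℤ) :=
  if k ≤ 2 ∨ l ≤ 2 then {(0, 0)}
  else
    blockSet (k - 1) l ∪
      (blockSet k (l - 1)).image
        (fun p => (p.1 + deltaX (k + l - 1), p.2 + deltaY (k + l - 1)))
termination_by k + l

/-- The vector `v_i = (3 (t - i), -3 i)`. -/
def stepVec (t i : ℕ) : ℤ × ℤ := (3 * ((t : ℤ) - i), -3 * (i : ℤ))

/-- The points `w_0 = (0, 0)`, `w_{i+1} = w_i + v_i`. The unit square `C_i` has lower left
corner `w_i`. -/
def squareCorner (t : ℕ) : ℕ → ℤ × ℤ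
  | 0 => (0, 0)
  | i + 1 => squareCorner t i + stepVec t i

/-- The lower left corner `q_i` of the square `D_i`, which is `C_i` scaled by the factor
`(t + 1) 4^(t+1)`. -/
def scaledCorner (t i : ℕ) : ℤ × ℤ :=
  (((t : ℤ) + 1) * 4 ^ (t + 1) * (squareCorner t i).1,
    ((t : ℤ) + 1) * 4 ^ (t + 1) * (squareCorner t i).2)

/-- The translate `S'_{t-i,i+2}` of `S_{t-i,i+2}` by `q_i`, placed in the square `D_i`. -/
def placedBlock (t i : ℕ) : Finset (ℤ × ℤ) :=
  (blockSet (t - i) (i + 2)).image (fun p => p + scaledCorner t i)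

/-- The integer point set `S_t`, the union of the `S'_{t-i,i+2}` for `0 ≤ i ≤ t - 2`
(the empty union if `t = 1`). -/
def esSet (t : ℕ) : Finset (ℤ × ℤ) :=
  (Finset.range (t - 1)).biUnion (placedBlock t)

/-- A finite set of integer points, seen as a subset of the real plane. -/
def toPlane (S : Finset (ℤ × ℤ)) : Set (ℝ × ℝ) :=
  (fun p : ℤ × ℤ => ((p.1 : ℝ), (p.2 : ℝ))) '' (S : Set (ℤ × ℤ))

/-- `P` is a convex `k`-gon of `S`: the convex hull of finitely many points of the plane that
has exactly `k` vertices (extreme points), all of them in `S`. For `k ≥ 3` this is a convex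
polygon in the usual sense; single points and segments are allowed as the degenerate cases
`k = 1` and `k = 2`. -/
structure IsConvexGon (S : Set (ℝ × ℝ)) (k : ℕ) (P : Set (ℝ × ℝ)) : Prop where
  eq_convexHull : ∃ V : Finset (ℝ × ℝ), P = convexHull ℝ (V : Set (ℝ × ℝ))
  vertices_subset : P.extremePoints ℝ ⊆ S
  card_vertices : (P.extremePoints ℝ).ncard = k

/-!
The set `S_t` is the Erdős–Szekeres construction. Below, `r = k + l - 1`.

Inside a block `S_{k,l}` all slopes lie strictly between `1` and `r + 1` (`blockSet_slope`), while
the segments from the left part `S_{k-1,l}` to the right part, a translate of `S_{k,l-1}`, have slope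
greater than `r` (`blockSet_cross`), hence greater than every slope inside either part. So a cup
that meets the left part has at most one point in the right part, and a cap that meets the right
part has at most one point in the left part. By induction cups of `S_{k,l}` have at most `k - 1`
points (`IsCup.card_le`) and caps at most `l - 1` points (`IsCap.card_le`).

The blocks of `S_t` follow each other from left to right, segments between different blocks have
slope less than `1` (`placedBlock_cross`), and points from three different blocks form a right turn
(`placedBlock_turn_neg`). Let `A` be a subset of `S_t` in convex position.

* If `A` lies in the block `i`, it is the union of a cap and a cup sharing a point, so it has at most
  `(i + 1) + (t - i - 1) - 1 = t - 1` points.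
* Otherwise let `m < n` be the first and the last block that `A` meets. The part of `A` in the block
  `m` is a cap, as a point of the block `n` lies below all lines joining two of its points;
  symmetrically the part in the block `n` is a cup; and each of the `n - m - 1` blocks in between
  contains at most one point of `A`. The total is at most `(m + 1) + (t - n - 1) + (n - m - 1) = t - 1`.

All of these steps use convex position in one form only (`InConvexPosition`): a point that lies on or
below one chord and on or above another is in the convex hull of the remaining points.
-/

/-! ### Cups, caps and convex position -/

/-- The cross product of `q - p` and `r - q`. For `p.1 < q.1 < r.1` it is positive when `q` lies
below the line `pr`, negative when `q` lies above it, and zero when the points are collinear. -/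
def turn (p q r : ℤ × ℤ) : ℤ := (q.1 - p.1) * (r.2 - q.2) - (q.2 - p.2) * (r.1 - q.1)

/-- A cup: every point lies strictly below each chord whose endpoints are on either side of it. -/
def IsCup (A : Finset (ℤ × ℤ)) : Prop :=
  ∀ p ∈ A, ∀ q ∈ A, ∀ r ∈ A, p.1 < q.1 → q.1 < r.1 → 0 < turn p q r

/-- A cap: every point lies strictly above each chord whose endpoints are on either side of it. -/
def IsCap (A : Finset (ℤ × ℤ)) : Prop :=
  ∀ p ∈ A, ∀ q ∈ A, ∀ r ∈ A, p.1 < q.1 → q.1 < r.1 → turn p q r < 0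

/-- Convex position: no point lies both weakly below one chord and weakly above another. This
is the only consequence of convex independence that the counting argument uses. -/
def InConvexPosition (A : Finset (ℤ × ℤ)) : Prop :=
  ∀ q ∈ A, ∀ a ∈ A, ∀ c ∈ A, ∀ a' ∈ A, ∀ c' ∈ A, a.1 < q.1 → q.1 < c.1 →
    a'.1 < q.1 → q.1 < c'.1 → 0 ≤ turn a q c → turn a' q c' ≤ 0 → False

theorem IsCup.mono {A B : Finset (ℤ × ℤ)} (h : IsCup B) (hAB : A ⊆ B) : IsCup A :=
  fun p hp q hq r hr => h p (hAB hp) q (hAB hq) r (hAB hr)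

theorem IsCap.mono {A B : Finset (ℤ × ℤ)} (h : IsCap B) (hAB : A ⊆ B) : IsCap A :=
  fun p hp q hq r hr => h p (hAB hp) q (hAB hq) r (hAB hr)

/-- A slope above `c` followed by a slope below `c` is a right turn. -/
theorem turn_neg_of_slopes {p q r : ℤ × ℤ} (c : ℤ) (hpq : p.1 < q.1) (hqr : q.1 < r.1)
    (h₁ : c * (q.1 - p.1) < q.2 - p.2) (h₂ : r.2 - q.2 < c * (r.1 - q.1)) :
    turn p q r < 0 := by
  unfold turn
  nlinarith [mul_pos (sub_pos.2 hpq) (sub_pos.2 h₂), mul_pos (sub_pos.2 hqr) (sub_pos.2 h₁)]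

/-- A slope below `c` followed by a slope above `c` is a left turn. -/
theorem turn_pos_of_slopes {p q r : ℤ × ℤ} (c : ℤ) (hpq : p.1 < q.1) (hqr : q.1 < r.1)
    (h₁ : q.2 - p.2 < c * (q.1 - p.1)) (h₂ : c * (r.1 - q.1) < r.2 - q.2) :
    0 < turn p q r := by
  unfold turn
  nlinarith [mul_pos (sub_pos.2 hpq) (sub_pos.2 h₂), mul_pos (sub_pos.2 hqr) (sub_pos.2 h₁)]

/-! ### Slopes inside the sets `S_{k,l}` -/

theorem blockSet_of_le {k l : ℕ} (h : k ≤ 2 ∨ l ≤ 2) : blockSet k l = {(0, 0)} := by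
  rw [blockSet, if_pos h]

theorem mem_blockSet_of_not_le {k l : ℕ} (h : ¬(k ≤ 2 ∨ l ≤ 2)) {p : ℤ × ℤ} :
    p ∈ blockSet k l ↔ p ∈ blockSet (k - 1) l ∨ ∃ p' ∈ blockSet k (l - 1),
      p = p' + (deltaX (k + l - 1), deltaY (k + l - 1)) := by
  rw [blockSet, if_neg h, Finset.mem_union, Finset.mem_image]
  simp only [eq_comm (a := p)]
  rfl

/-- The set `S_{k,l}` lies in a box, and in a strip bounded by two lines of slope
`r + 1`, where `r = k + l - 1`. The
strip gives the slope estimates; the box alone is too coarse for them. -/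
theorem blockSet_bounds (k l : ℕ) : ∀ p ∈ blockSet k l,
    0 ≤ p.1 ∧ p.1 < 4 ^ (k + l - 1) ∧
    -4 ^ (k + l - 1) < p.2 - ((k + l - 1 : ℕ) + 1 : ℤ) * p.1 ∧
    p.2 ≤ ((k + l - 1 : ℕ) + 1 : ℤ) * p.1 ∧
    0 ≤ p.2 ∧ p.2 ≤ ((k + l - 1 : ℕ) : ℤ) * 4 ^ (k + l - 1) := by
  induction k, l using blockSet.induct with
  | case1 k l h =>
    intro p hp
    rw [blockSet_of_le h, Finset.mem_singleton] at hp
    subst hp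
    simp
  | case2 k l h ih₁ ih₂ =>
    intro p hp
    obtain ⟨n, hn⟩ : ∃ n, k + l - 1 = n + 1 := ⟨k + l - 2, by omega⟩
    have hn₁ : k - 1 + l - 1 = n := by omega
    have hn₂ : k + (l - 1) - 1 = n := by omega
    rw [hn₁] at ih₁
    rw [hn₂] at ih₂
    rw [mem_blockSet_of_not_le h] at hp
    rw [hn] at hp ⊢
    have h4 : (0 : ℤ) < 4 ^ n := by positivity
    have hn4 : (0 : ℤ) ≤ n * 4 ^ n := by positivity
    rcases hp with hp | ⟨p', hp', rfl⟩
    · obtain ⟨h1, h2, h3, h5, h6, h7⟩ := ih₁ p hp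
      push_cast
      rw [pow_succ]
      refine ⟨h1, by linarith, by linarith, by linarith, h6, by linarith⟩
    · obtain ⟨h1, h2, h3, h5, h6, h7⟩ := ih₂ p' hp'
      simp only [deltaX, deltaY, Prod.fst_add, Prod.snd_add, Nat.add_sub_cancel]
      push_cast
      rw [pow_succ]
      refine ⟨by linarith, by linarith, by linarith, by linarith, by linarith, by linarith⟩

/-- Segments from `S_{k-1,l}` to the translate of `S_{k,l-1}` go to the right, with slope strictly
between `r` and `r + 1`, where `r = k + l - 1`. -/
theorem blockSet_cross {k l : ℕ} (h : ¬(k ≤ 2 ∨ l ≤ 2)) {p q : ℤ × ℤ}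
    (hp : p ∈ blockSet (k - 1) l) (hq : q ∈ blockSet k (l - 1)) :
    p.1 < q.1 + deltaX (k + l - 1) ∧
    ((k + l - 1 : ℕ) : ℤ) * (q.1 + deltaX (k + l - 1) - p.1) < q.2 + deltaY (k + l - 1) - p.2 ∧
    q.2 + deltaY (k + l - 1) - p.2 <
      ((k + l - 1 : ℕ) + 1 : ℤ) * (q.1 + deltaX (k + l - 1) - p.1) := by
  obtain ⟨n, hn⟩ : ∃ n, k + l - 1 = n + 1 := ⟨k + l - 2, by omega⟩
  have hn₁ : k - 1 + l - 1 = n := by omega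
  have hn₂ : k + (l - 1) - 1 = n := by omega
  have hp' := blockSet_bounds _ _ p hp
  have hq' := blockSet_bounds _ _ q hq
  rw [hn₁] at hp'
  rw [hn₂] at hq'
  rw [hn]
  obtain ⟨h1, h2, h3, h5, -, -⟩ := hp'
  obtain ⟨g1, g2, g3, g5, -, -⟩ := hq'
  have h4 : (0 : ℤ) < 4 ^ n := by positivity
  simp only [deltaX, deltaY, Nat.add_sub_cancel]
  push_cast
  refine ⟨by linarith, by linarith, by linarith⟩

/-- Only the upper bound is needed inside `S_{k,l}`; the lower bound `1` is what separates these
slopes from those of segments between different placed blocks. -/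
theorem blockSet_slope (k l : ℕ) : ∀ p ∈ blockSet k l, ∀ q ∈ blockSet k l, p.1 < q.1 →
    q.1 - p.1 < q.2 - p.2 ∧ q.2 - p.2 < ((k + l - 1 : ℕ) + 1 : ℤ) * (q.1 - p.1) := by
  induction k, l using blockSet.induct with
  | case1 k l h =>
    intro p hp q hq hpq
    rw [blockSet_of_le h, Finset.mem_singleton] at hp hq
    subst hp hq
    exact absurd hpq (lt_irrefl _)
  | case2 k l h ih₁ ih₂ =>
    intro p hp q hq hpq
    have hn₁ : k - 1 + l - 1 = k + l - 1 - 1 := by omega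
    have hn₂ : k + (l - 1) - 1 = k + l - 1 - 1 := by omega
    have hn : ((k + l - 1 - 1 : ℕ) : ℤ) = ((k + l - 1 : ℕ) : ℤ) - 1 := by omega
    rw [hn₁, hn] at ih₁
    rw [hn₂, hn] at ih₂
    have hr : (1 : ℤ) ≤ (k + l - 1 : ℕ) := by omega
    rw [mem_blockSet_of_not_le h] at hp hq
    rcases hp with hp | ⟨p', hp, rfl⟩ <;> rcases hq with hq | ⟨q', hq, rfl⟩
    · obtain ⟨h1, h2⟩ := ih₁ p hp q hq hpq
      exact ⟨h1, by linarith⟩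
    · obtain ⟨-, h1, h2⟩ := blockSet_cross h hp hq
      simp only [Prod.fst_add, Prod.snd_add] at hpq ⊢
      exact ⟨by nlinarith, h2⟩
    · have h1 := (blockSet_cross h hq hp).1
      simp only [Prod.fst_add] at hpq
      linarith
    · simp only [Prod.fst_add, Prod.snd_add] at hpq ⊢
      obtain ⟨h1, h2⟩ := ih₂ p' hp q' hq (by linarith)
      exact ⟨by linarith, by linarith⟩

theorem blockSet_injOn_fst (k l : ℕ) :
    ∀ p ∈ blockSet k l, ∀ q ∈ blockSet k l, p.1 = q.1 → p = q := by
  induction k, l using blockSet.induct with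
  | case1 k l h =>
    intro p hp q hq _
    rw [blockSet_of_le h, Finset.mem_singleton] at hp hq
    rw [hp, hq]
  | case2 k l h ih₁ ih₂ =>
    intro p hp q hq hpq
    rw [mem_blockSet_of_not_le h] at hp hq
    rcases hp with hp | ⟨p', hp, rfl⟩ <;> rcases hq with hq | ⟨q', hq, rfl⟩
    · exact ih₁ p hp q hq hpq
    · exact absurd hpq (blockSet_cross h hp hq).1.ne
    · exact absurd hpq (blockSet_cross h hq hp).1.ne'
    · rw [ih₂ p' hp q' hq (by simpa using hpq)]

/-! ### Cups and caps in the sets `S_{k,l}` -/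

/-- A finite set whose points have distinct abscissas either has at most one point or contains
two points, one to the left of the other. -/
theorem card_le_one_or_exists_lt {A : Finset (ℤ × ℤ)}
    (hA : ∀ p ∈ A, ∀ q ∈ A, p.1 = q.1 → p = q) :
    A.card ≤ 1 ∨ ∃ p ∈ A, ∃ q ∈ A, p.1 < q.1 := by
  by_contra! h
  refine h.1.not_ge (Finset.card_le_one.2 fun p hp q hq => hA p hp q hq ?_)
  exact le_antisymm (h.2 q hq p hp) (h.2 p hp q hq)

/-- A subset of a translate of `S_{k,l}` splits along the recursion into subsets of translates of
`S_{k-1,l}` and `S_{k,l-1}`. -/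
theorem exists_split {k l : ℕ} (h : ¬(k ≤ 2 ∨ l ≤ 2)) {v : ℤ × ℤ} {A : Finset (ℤ × ℤ)}
    (hA : A ⊆ (blockSet k l).image (· + v)) :
    ∃ L R, A = L ∪ R ∧ L ⊆ (blockSet (k - 1) l).image (· + v) ∧
      R ⊆ (blockSet k (l - 1)).image
        (· + ((deltaX (k + l - 1), deltaY (k + l - 1)) + v)) := by
  refine ⟨A.filter (· ∈ (blockSet (k - 1) l).image (· + v)),
    A.filter (· ∈ (blockSet k (l - 1)).image
        (· + ((deltaX (k + l - 1), deltaY (k + l - 1)) + v))), ?_,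
    fun p hp => (Finset.mem_filter.1 hp).2, fun p hp => (Finset.mem_filter.1 hp).2⟩
  rw [← Finset.filter_or, Finset.filter_true_of_mem]
  intro p hp
  obtain ⟨q, hq, rfl⟩ := Finset.mem_image.1 (hA hp)
  rcases (mem_blockSet_of_not_le h).1 hq with hq' | ⟨q', hq', rfl⟩
  · exact Or.inl (Finset.mem_image_of_mem _ hq')
  · exact Or.inr (Finset.mem_image.2 ⟨q', hq', (add_assoc _ _ _).symm⟩)

theorem image_blockSet_injOn_fst {k l : ℕ} {v : ℤ × ℤ} :
    ∀ p ∈ (blockSet k l).image (· + v), ∀ q ∈ (blockSet k l).image (· + v),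
      p.1 = q.1 → p = q := by
  intro p hp q hq hpq
  obtain ⟨p, hp', rfl⟩ := Finset.mem_image.1 hp
  obtain ⟨q, hq', rfl⟩ := Finset.mem_image.1 hq
  rw [blockSet_injOn_fst k l p hp' q hq' (by simpa using hpq)]

theorem image_blockSet_slope {k l : ℕ} {v : ℤ × ℤ} {p q : ℤ × ℤ}
    (hp : p ∈ (blockSet k l).image (· + v)) (hq : q ∈ (blockSet k l).image (· + v))
    (hpq : p.1 < q.1) :
    q.1 - p.1 < q.2 - p.2 ∧ q.2 - p.2 < ((k + l - 1 : ℕ) + 1 : ℤ) * (q.1 - p.1) := by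
  obtain ⟨p, hp', rfl⟩ := Finset.mem_image.1 hp
  obtain ⟨q, hq', rfl⟩ := Finset.mem_image.1 hq
  simpa using blockSet_slope k l p hp' q hq' (by simpa using hpq)

theorem image_blockSet_cross {k l : ℕ} (h : ¬(k ≤ 2 ∨ l ≤ 2)) {v : ℤ × ℤ} {p q : ℤ × ℤ}
    (hp : p ∈ (blockSet (k - 1) l).image (· + v))
    (hq : q ∈ (blockSet k (l - 1)).image
        (· + ((deltaX (k + l - 1), deltaY (k + l - 1)) + v))) :
    p.1 < q.1 ∧ ((k + l - 1 : ℕ) : ℤ) * (q.1 - p.1) < q.2 - p.2 := by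
  obtain ⟨p, hp', rfl⟩ := Finset.mem_image.1 hp
  obtain ⟨q, hq', rfl⟩ := Finset.mem_image.1 hq
  obtain ⟨h1, h2, -⟩ := blockSet_cross h hp' hq'
  simp only [Prod.fst_add, Prod.snd_add]
  refine ⟨by linarith, by linarith⟩

/-- A translate of `S_{k,l}` contains no cup with `k` points. -/
theorem IsCup.card_le (k l : ℕ) : 2 ≤ k → 2 ≤ l → ∀ (v : ℤ × ℤ) (A : Finset (ℤ × ℤ)),
    A ⊆ (blockSet k l).image (· + v) → IsCup A → A.card ≤ k - 1 := by
  induction k, l using blockSet.induct with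
  | case1 k l h =>
    intro hk _ v A hA _
    have := Finset.card_le_card hA
    rw [blockSet_of_le h, Finset.image_singleton, Finset.card_singleton] at this
    omega
  | case2 k l h ih₁ ih₂ =>
    intro hk hl v A hA hcup
    obtain ⟨L, R, rfl, hL, hR⟩ := exists_split h hA
    have hLc := ih₁ (by omega) hl v L hL (hcup.mono Finset.subset_union_left)
    have hRc := ih₂ hk (by omega) _ R hR (hcup.mono Finset.subset_union_right)
    have hu := Finset.card_union_le L R
    rcases L.eq_empty_or_nonempty with rfl | ⟨p, hp⟩
    · simpa using hRc
    -- A chord inside `R` is flatter than the chord leading to it from a point of `L`.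
    · rcases card_le_one_or_exists_lt
        (fun p hp q hq => image_blockSet_injOn_fst p (hR hp) q (hR hq))
        with h1 | ⟨q, hq, r, hr, hqr⟩
      · omega
      · obtain ⟨h1, h2⟩ := image_blockSet_cross h (hL hp) (hR hq)
        have h3 := (image_blockSet_slope (hR hq) (hR hr) hqr).2
        have hn : ((k + (l - 1) - 1 : ℕ) + 1 : ℤ) = ((k + l - 1 : ℕ) : ℤ) := by omega
        rw [hn] at h3
        have := hcup p (Finset.mem_union_left _ hp) q (Finset.mem_union_right _ hq) r
          (Finset.mem_union_right _ hr) h1 hqr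
        exact absurd this (turn_neg_of_slopes _ h1 hqr h2 h3).not_gt

/-- A translate of `S_{k,l}` contains no cap with `l` points. -/
theorem IsCap.card_le (k l : ℕ) : 2 ≤ k → 2 ≤ l → ∀ (v : ℤ × ℤ) (A : Finset (ℤ × ℤ)),
    A ⊆ (blockSet k l).image (· + v) → IsCap A → A.card ≤ l - 1 := by
  induction k, l using blockSet.induct with
  | case1 k l h =>
    intro _ hl v A hA _
    have := Finset.card_le_card hA
    rw [blockSet_of_le h, Finset.image_singleton, Finset.card_singleton] at this
    omega
  | case2 k l h ih₁ ih₂ =>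
    intro hk hl v A hA hcap
    obtain ⟨L, R, rfl, hL, hR⟩ := exists_split h hA
    have hLc := ih₁ (by omega) hl v L hL (hcap.mono Finset.subset_union_left)
    have hRc := ih₂ hk (by omega) _ R hR (hcap.mono Finset.subset_union_right)
    have hu := Finset.card_union_le L R
    rcases R.eq_empty_or_nonempty with rfl | ⟨r, hr⟩
    · simpa using hLc
    -- A chord inside `L` is flatter than the chord leading from it to a point of `R`.
    · rcases card_le_one_or_exists_lt
        (fun p hp q hq => image_blockSet_injOn_fst p (hL hp) q (hL hq))
        with h1 | ⟨p, hp, q, hq, hpq⟩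
      · omega
      · obtain ⟨h1, h2⟩ := image_blockSet_cross h (hL hq) (hR hr)
        have h3 := (image_blockSet_slope (hL hp) (hL hq) hpq).2
        have hn : ((k - 1 + l - 1 : ℕ) + 1 : ℤ) = ((k + l - 1 : ℕ) : ℤ) := by omega
        rw [hn] at h3
        have := hcap p (Finset.mem_union_left _ hp) q (Finset.mem_union_left _ hq) r
          (Finset.mem_union_right _ hr) hpq h1
        exact absurd this (turn_pos_of_slopes _ hpq h1 h3 h2).not_gt

/-! ### The arrangement of the placed blocks -/

theorem two_mul_squareCorner (t i : ℕ) :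
    2 * (squareCorner t i).1 = 3 * i * (2 * t - (i - 1)) ∧
    2 * (squareCorner t i).2 = -(3 * i * (i - 1)) := by
  induction i with
  | zero => simp [squareCorner]
  | succ i ih =>
    obtain ⟨h1, h2⟩ := ih
    simp only [squareCorner, stepVec, Prod.fst_add, Prod.snd_add, mul_add, h1, h2]
    push_cast
    constructor <;> ring

/-- Every point of a placed block lies in the square `D_i`, of side `(t + 1) 4 ^ (t + 1)`. -/
theorem placedBlock_bounds {t i : ℕ} (hi : i + 2 ≤ t) {p : ℤ × ℤ} (hp : p ∈ placedBlock t i) :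
    ∃ e : ℤ × ℤ, p = e + scaledCorner t i ∧
      0 ≤ e.1 ∧ e.1 ≤ ((t : ℤ) + 1) * 4 ^ (t + 1) ∧
      0 ≤ e.2 ∧ e.2 ≤ ((t : ℤ) + 1) * 4 ^ (t + 1) := by
  obtain ⟨e, he, rfl⟩ := Finset.mem_image.1 hp
  obtain ⟨h1, h2, -, -, h5, h6⟩ := blockSet_bounds _ _ e he
  have hn : t - i + (i + 2) - 1 = t + 1 := by omega
  rw [hn] at h2 h6
  push_cast at h6
  have : (0 : ℤ) ≤ t * 4 ^ (t + 1) := by positivity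
  exact ⟨e, rfl, h1, by linarith, h5, h6⟩

/-- Segments between different placed blocks have slope less than `1`. -/
theorem placedBlock_cross {t i j : ℕ} (hij : i < j) (hj : j + 2 ≤ t) {p q : ℤ × ℤ}
    (hp : p ∈ placedBlock t i) (hq : q ∈ placedBlock t j) :
    p.1 < q.1 ∧ q.2 - p.2 < q.1 - p.1 := by
  obtain ⟨d, rfl, d1, d2, d3, d4⟩ := placedBlock_bounds (by omega) hp
  obtain ⟨e, rfl, e1, e2, e3, e4⟩ := placedBlock_bounds hj hq
  simp only [scaledCorner, Prod.fst_add, Prod.snd_add]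
  have hM : (0 : ℤ) < ((t : ℤ) + 1) * 4 ^ (t + 1) := by positivity
  set M : ℤ := ((t : ℤ) + 1) * 4 ^ (t + 1)
  obtain ⟨hi1, hi2⟩ := two_mul_squareCorner t i
  obtain ⟨hj1, hj2⟩ := two_mul_squareCorner t j
  obtain ⟨m, rfl⟩ : ∃ m, j = i + 1 + m := ⟨j - (i + 1), by omega⟩
  obtain ⟨s, rfl⟩ : ∃ s, t = i + 1 + m + 2 + s := ⟨t - (i + 1 + m + 2), by omega⟩
  have hx : 6 ≤ (squareCorner (i + 1 + m + 2 + s) (i + 1 + m)).1 -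
      (squareCorner (i + 1 + m + 2 + s) i).1 := by
    push_cast at hi1 hj1
    have h0 : (0 : ℤ) ≤ m * i + m * m + m * s + i + m + s := by positivity
    nlinarith
  have hy : (squareCorner (i + 1 + m + 2 + s) (i + 1 + m)).2 -
      (squareCorner (i + 1 + m + 2 + s) i).2 ≤ 0 := by
    push_cast at hi2 hj2
    have h0 : (0 : ℤ) ≤ m * i + m * m + i + m := by positivity
    nlinarith
  have hx' := mul_le_mul_of_nonneg_left hx hM.le
  have hy' := mul_le_mul_of_nonneg_left hy hM.le
  constructor <;> linarith

/-- The sum of the vectors `v_i, …, v_{i+m-1}`, doubled, is `3 m (2 t - s, -s)` with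
`s = 2 i + m - 1`. Two consecutive such sums form a right turn that is stable under perturbing
every coordinate by at most `1`, here scaled by `M`. -/
theorem perturbed_turn_neg {t m l s M u₁ u₂ v₁ v₂ d₁ d₂ e₁ e₂ : ℤ}
    (hM : 0 < M) (hm : 1 ≤ m) (hl : 1 ≤ l) (hs : 0 ≤ s) (ht : s + m + l ≤ 2 * t)
    (hu₁ : 2 * u₁ = 3 * m * (2 * t - s)) (hu₂ : 2 * u₂ = -(3 * m * s))
    (hv₁ : 2 * v₁ = 3 * l * (2 * t - (s + m + l))) (hv₂ : 2 * v₂ = -(3 * l * (s + m + l)))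
    (hd₁ : |d₁| ≤ M) (hd₂ : |d₂| ≤ M) (he₁ : |e₁| ≤ M) (he₂ : |e₂| ≤ M) :
    (M * u₁ + d₁) * (M * v₂ + e₂) - (M * u₂ + d₂) * (M * v₁ + e₁) < 0 := by
  have hu₁' : 0 ≤ u₁ := by
    have := mul_nonneg (by linarith : (0 : ℤ) ≤ m) (by linarith : 0 ≤ 2 * t - s)
    linarith
  have hu₂' : 0 ≤ -u₂ := by
    have := mul_nonneg (by linarith : (0 : ℤ) ≤ m) hs
    linarith
  have hv₁' : 0 ≤ v₁ := by
    have := mul_nonneg (by linarith : (0 : ℤ) ≤ l) (by linarith : 0 ≤ 2 * t - (s + m + l))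
    linarith
  have hv₂' : 0 ≤ -v₂ := by
    have := mul_nonneg (by linarith : (0 : ℤ) ≤ l) (by linarith : 0 ≤ s + m + l)
    linarith
  have hcross : 2 * (u₁ * v₂ - u₂ * v₁) = -(9 * t * (m + l) * (m * l)) := by
    have : 4 * (u₁ * v₂ - u₂ * v₁) = (2 * u₁) * (2 * v₂) - (2 * u₂) * (2 * v₁) := by ring
    rw [hu₁, hu₂, hv₁, hv₂] at this
    linarith
  have hsu : u₁ - u₂ = 3 * (t * m) := by linarith
  have hsv : v₁ - v₂ = 3 * (t * l) := by linarith
  have b₃ : d₁ * e₂ - d₂ * e₁ ≤ 2 * (M * M) := by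
    have h₁ : |d₁ * e₂| ≤ M * M := by
      rw [abs_mul]
      exact mul_le_mul hd₁ he₂ (abs_nonneg _) hM.le
    have h₂ : |d₂ * e₁| ≤ M * M := by
      rw [abs_mul]
      exact mul_le_mul hd₂ he₁ (abs_nonneg _) hM.le
    linarith [(abs_le.1 h₁).2, (abs_le.1 h₂).1]
  rw [abs_le] at hd₁ hd₂ he₁ he₂
  have b₁ : u₁ * e₂ - u₂ * e₁ ≤ M * (3 * (t * m)) := by
    rw [← hsu]
    nlinarith [mul_le_mul_of_nonneg_left he₂.2 hu₁', mul_le_mul_of_nonneg_left he₁.2 hu₂']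
  have b₂ : d₁ * v₂ - d₂ * v₁ ≤ M * (3 * (t * l)) := by
    rw [← hsv]
    nlinarith [mul_le_mul_of_nonneg_left hd₁.1 hv₂', mul_le_mul_of_nonneg_left hd₂.1 hv₁']
  have hml : 1 ≤ m * l := by nlinarith
  have html : 2 ≤ t * (m + l) := by nlinarith
  have hfin : 6 * (t * (m + l)) + 4 < 9 * t * (m + l) * (m * l) := by nlinarith
  have hMM : 0 < M * M := by positivity
  have b₀ := mul_lt_mul_of_pos_left hfin hMM
  have b₁' := mul_le_mul_of_nonneg_left b₁ hM.le
  have b₂' := mul_le_mul_of_nonneg_left b₂ hM.le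
  have hc' : M * M * (2 * (u₁ * v₂ - u₂ * v₁)) = M * M * -(9 * t * (m + l) * (m * l)) := by
    rw [hcross]
  linarith

/-- Three points from three different placed blocks form a right turn. -/
theorem placedBlock_turn_neg {t i j k : ℕ} (hij : i < j) (hjk : j < k) (hk : k + 2 ≤ t)
    {p q r : ℤ × ℤ} (hp : p ∈ placedBlock t i) (hq : q ∈ placedBlock t j)
    (hr : r ∈ placedBlock t k) : turn p q r < 0 := by
  obtain ⟨d, rfl, d1, d2, d3, d4⟩ := placedBlock_bounds (by omega) hp
  obtain ⟨e, rfl, e1, e2, e3, e4⟩ := placedBlock_bounds (by omega) hq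
  obtain ⟨f, rfl, f1, f2, f3, f4⟩ := placedBlock_bounds hk hr
  simp only [turn, scaledCorner, Prod.fst_add, Prod.snd_add]
  have hM : (0 : ℤ) < ((t : ℤ) + 1) * 4 ^ (t + 1) := by positivity
  set M : ℤ := ((t : ℤ) + 1) * 4 ^ (t + 1)
  obtain ⟨hi1, hi2⟩ := two_mul_squareCorner t i
  obtain ⟨hj1, hj2⟩ := two_mul_squareCorner t j
  obtain ⟨hk1, hk2⟩ := two_mul_squareCorner t k
  have key := perturbed_turn_neg (t := t) (m := (j : ℤ) - i) (l := (k : ℤ) - j)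
    (s := (i : ℤ) + j - 1) (M := M)
    (u₁ := (squareCorner t j).1 - (squareCorner t i).1)
    (u₂ := (squareCorner t j).2 - (squareCorner t i).2)
    (v₁ := (squareCorner t k).1 - (squareCorner t j).1)
    (v₂ := (squareCorner t k).2 - (squareCorner t j).2)
    (d₁ := e.1 - d.1) (d₂ := e.2 - d.2) (e₁ := f.1 - e.1) (e₂ := f.2 - e.2)
    hM (by omega) (by omega) (by omega) (by omega)
    (by linarith) (by linarith) (by linarith) (by linarith)
    (abs_le.2 ⟨by linarith, by linarith⟩) (abs_le.2 ⟨by linarith, by linarith⟩)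
    (abs_le.2 ⟨by linarith, by linarith⟩) (abs_le.2 ⟨by linarith, by linarith⟩)
  linarith

theorem placedBlock_slope {t i : ℕ} {p q : ℤ × ℤ} (hp : p ∈ placedBlock t i)
    (hq : q ∈ placedBlock t i) (hpq : p.1 < q.1) : q.1 - p.1 < q.2 - p.2 :=
  (image_blockSet_slope hp hq hpq).1

/-! ### Points of `S_t` in convex position -/

/-- In convex position every point is strictly above all its chords or strictly below all of
them, and the leftmost point is vacuously both. So the set is the union of a cap and a cup that
share a point. -/
theorem InConvexPosition.exists_cap_cup {A : Finset (ℤ × ℤ)} (hA : InConvexPosition A)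
    (hne : A.Nonempty) : ∃ U L : Finset (ℤ × ℤ), U ⊆ A ∧ L ⊆ A ∧ IsCap U ∧ IsCup L ∧
      A.card + 1 ≤ U.card + L.card := by
  classical
  let U := A.filter fun q => ∀ a ∈ A, ∀ c ∈ A, a.1 < q.1 → q.1 < c.1 → turn a q c < 0
  let L := A.filter fun q => ∀ a ∈ A, ∀ c ∈ A, a.1 < q.1 → q.1 < c.1 → 0 < turn a q c
  have hU : U ⊆ A := Finset.filter_subset _ _
  have hL : L ⊆ A := Finset.filter_subset _ _
  refine ⟨U, L, hU, hL, ?_, ?_, ?_⟩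
  · exact fun p hp q hq r hr => (Finset.mem_filter.1 hq).2 p (hU hp) r (hU hr)
  · exact fun p hp q hq r hr => (Finset.mem_filter.1 hq).2 p (hL hp) r (hL hr)
  · obtain ⟨x, hx, hmin⟩ := A.exists_min_image Prod.fst hne
    have hxU : x ∈ U := Finset.mem_filter.2 ⟨hx, fun a ha c _ h => absurd h (hmin a ha).not_gt⟩
    have hxL : x ∈ L := Finset.mem_filter.2 ⟨hx, fun a ha c _ h => absurd h (hmin a ha).not_gt⟩
    have hsub : A ⊆ U ∪ L := by
      intro q hq
      by_contra hn
      simp only [U, L, Finset.mem_union, Finset.mem_filter, hq, true_and] at hn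
      push Not at hn
      obtain ⟨⟨a, ha, c, hc, h1, h2, h3⟩, ⟨a', ha', c', hc', h4, h5, h6⟩⟩ := hn
      exact hA q hq a ha c hc a' ha' c' hc' h1 h2 h4 h5 h3 h6
    have h1 : 1 ≤ (U ∩ L).card := Finset.card_pos.2 ⟨x, Finset.mem_inter.2 ⟨hxU, hxL⟩⟩
    have h2 := Finset.card_le_card hsub
    have h3 := Finset.card_union_add_card_inter U L
    omega

theorem InConvexPosition.card_le_of_subset_placedBlock {t i : ℕ} (hi : i + 2 ≤ t)
    {A : Finset (ℤ × ℤ)} (hA : InConvexPosition A) (hne : A.Nonempty)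
    (hsub : A ⊆ placedBlock t i) : A.card ≤ t - 1 := by
  obtain ⟨U, L, hU, hL, hcap, hcup, hc⟩ := hA.exists_cap_cup hne
  have h1 := hcap.card_le (t - i) (i + 2) (by omega) (by omega) _ U (hU.trans hsub)
  have h2 := hcup.card_le (t - i) (i + 2) (by omega) (by omega) _ L (hL.trans hsub)
  omega

/-- The points in a block that has a point of the set in a later block form a cap. -/
theorem InConvexPosition.isCap_inter {t i j : ℕ} (hij : i < j) (hj : j + 2 ≤ t)
    {A : Finset (ℤ × ℤ)} (hA : InConvexPosition A) {b : ℤ × ℤ} (hbA : b ∈ A)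
    (hb : b ∈ placedBlock t j) : IsCap (A ∩ placedBlock t i) := by
  intro p hp q hq r hr hpq hqr
  rw [Finset.mem_inter] at hp hq hr
  by_contra! hn
  obtain ⟨h1, h2⟩ := placedBlock_cross hij hj hq.2 hb
  -- If `q` were below `pr`, it would be in the triangle `p r b`, as it is above `pb`.
  refine hA q hq.1 p hp.1 r hr.1 p hp.1 b hbA hpq hqr hpq h1 hn
    (turn_neg_of_slopes 1 hpq h1 ?_ (by linarith)).le
  linarith [placedBlock_slope hp.2 hq.2 hpq]

/-- The points in a block that has a point of the set in an earlier block form a cup. -/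
theorem InConvexPosition.isCup_inter {t i j : ℕ} (hij : i < j) (hj : j + 2 ≤ t)
    {A : Finset (ℤ × ℤ)} (hA : InConvexPosition A) {a : ℤ × ℤ} (haA : a ∈ A)
    (ha : a ∈ placedBlock t i) : IsCup (A ∩ placedBlock t j) := by
  intro p hp q hq r hr hpq hqr
  rw [Finset.mem_inter] at hp hq hr
  by_contra! hn
  obtain ⟨h1, h2⟩ := placedBlock_cross hij hj ha hq.2
  -- If `q` were above `pr`, it would be in the triangle `p r a`, as it is below `ar`.
  refine hA q hq.1 a haA r hr.1 p hp.1 r hr.1 h1 hqr hpq hqr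
    (turn_pos_of_slopes 1 h1 hqr (by linarith) ?_).le hn
  linarith [placedBlock_slope hq.2 hr.2 hqr]

/-- A block strictly between two blocks that contain points of the set contributes at most one
point. -/
theorem InConvexPosition.card_inter_le_one {t i j k : ℕ} (hij : i < j) (hjk : j < k)
    (hk : k + 2 ≤ t) {A : Finset (ℤ × ℤ)} (hA : InConvexPosition A) {a b : ℤ × ℤ}
    (haA : a ∈ A) (ha : a ∈ placedBlock t i) (hbA : b ∈ A) (hb : b ∈ placedBlock t k) :
    (A ∩ placedBlock t j).card ≤ 1 := by
  refine (card_le_one_or_exists_lt ?_).resolve_right ?_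
  · exact fun p hp q hq => image_blockSet_injOn_fst p (Finset.mem_inter.1 hp).2 q
      (Finset.mem_inter.1 hq).2
  · rintro ⟨p, hp, q, hq, hpq⟩
    rw [Finset.mem_inter] at hp hq
    obtain ⟨h1, h2⟩ := placedBlock_cross hij (by omega) ha hp.2
    have h3 := (placedBlock_cross hjk hk hp.2 hb).1
    -- The point `p` is in the triangle `a q b`: it is below `aq` and above `ab`.
    refine hA p hp.1 a haA q hq.1 a haA b hbA h1 hpq h1 h3
      (turn_pos_of_slopes 1 h1 hpq (by linarith) ?_).le
      (placedBlock_turn_neg hij hjk hk ha hp.2 hb).le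
    linarith [placedBlock_slope hp.2 hq.2 hpq]

theorem InConvexPosition.card_le {t : ℕ} {A : Finset (ℤ × ℤ)} (hA : InConvexPosition A)
    (hsub : A ⊆ esSet t) : A.card ≤ t - 1 := by
  classical
  rcases A.eq_empty_or_nonempty with rfl | hne
  · simp
  -- The indices of the blocks that contain a point of `A`.
  let I := (Finset.range (t - 1)).filter fun i => (A ∩ placedBlock t i).Nonempty
  have hmem : ∀ p ∈ A, ∃ i ∈ I, p ∈ placedBlock t i := by
    intro p hp
    obtain ⟨i, hi, hpi⟩ := Finset.mem_biUnion.1 (hsub hp)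
    exact ⟨i, Finset.mem_filter.2 ⟨hi, p, Finset.mem_inter.2 ⟨hp, hpi⟩⟩, hpi⟩
  have hI : I.Nonempty := by
    obtain ⟨p, hp⟩ := hne
    obtain ⟨i, hi, -⟩ := hmem p hp
    exact ⟨i, hi⟩
  obtain ⟨ha', a, ha⟩ := Finset.mem_filter.1 (I.min'_mem hI)
  obtain ⟨hb', b, hb⟩ := Finset.mem_filter.1 (I.max'_mem hI)
  rw [Finset.mem_inter] at ha hb
  rw [Finset.mem_range] at ha' hb'
  have hlo : ∀ i ∈ I, I.min' hI ≤ i := fun i hi => I.min'_le i hi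
  have hhi : ∀ i ∈ I, i ≤ I.max' hI := fun i hi => I.le_max' i hi
  generalize I.min' hI = m at *
  generalize I.max' hI = n at *
  have hmn' : m ≤ n := by
    obtain ⟨i, hi, -⟩ := hmem a ha.1
    exact (hlo i hi).trans (hhi i hi)
  rcases hmn'.eq_or_lt with rfl | hmn
  · refine hA.card_le_of_subset_placedBlock (i := m) (by omega) hne fun p hp => ?_
    obtain ⟨i, hi, hpi⟩ := hmem p hp
    rwa [le_antisymm (hlo i hi) (hhi i hi)]
  · have hcap := hA.isCap_inter hmn (by omega) hb.1 hb.2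
    have hcup := hA.isCup_inter hmn (by omega) ha.1 ha.2
    have h1 : (A ∩ placedBlock t m).card ≤ m + 2 - 1 :=
      hcap.card_le (t - m) (m + 2) (by omega) (by omega) _ _ Finset.inter_subset_right
    have h2 : (A ∩ placedBlock t n).card ≤ t - n - 1 :=
      hcup.card_le (t - n) (n + 2) (by omega) (by omega) _ _ Finset.inter_subset_right
    have h3 := Finset.card_biUnion_le_card_mul (Finset.Ioo m n)
      (fun i => A ∩ placedBlock t i) 1 fun i hi =>
        hA.card_inter_le_one (Finset.mem_Ioo.1 hi).1 (Finset.mem_Ioo.1 hi).2 (by omega : n + 2 ≤ t)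
          ha.1 ha.2 hb.1 hb.2
    rw [Nat.card_Ioo] at h3
    have hcover : A ⊆ (A ∩ placedBlock t m ∪ A ∩ placedBlock t n) ∪
        (Finset.Ioo m n).biUnion fun i => A ∩ placedBlock t i := by
      intro p hp
      obtain ⟨i, hi, hpi⟩ := hmem p hp
      have hpi' := Finset.mem_inter.2 ⟨hp, hpi⟩
      rw [Finset.mem_union, Finset.mem_union, Finset.mem_biUnion]
      rcases (hlo i hi).eq_or_lt with rfl | hmi
      · exact Or.inl (Or.inl hpi')
      rcases (hhi i hi).eq_or_lt with rfl | hin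
      · exact Or.inl (Or.inr hpi')
      · exact Or.inr ⟨i, Finset.mem_Ioo.2 ⟨hmi, hin⟩, hpi'⟩
    have h4 := (Finset.card_le_card hcover).trans (Finset.card_union_le _ _)
    have h5 := Finset.card_union_le (A ∩ placedBlock t m) (A ∩ placedBlock t n)
    omega

/-! ### From extreme points to convex position -/

theorem Convex.mk_mem_of_mem_of_le {s : Set (ℝ × ℝ)} (hs : Convex ℝ s) {x y₁ y₂ y : ℝ}
    (h₁ : (x, y₁) ∈ s) (h₂ : (x, y₂) ∈ s) (h : y₁ ≤ y) (h' : y ≤ y₂) : (x, y) ∈ s := by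
  have hc : Convex ℝ {z : ℝ | (x, z) ∈ s} := by
    intro z hz w hw a b ha hb hab
    have := hs hz hw ha hb hab
    simpa [← add_mul, hab] using this
  exact hc.ordConnected.out h₁ h₂ ⟨h, h'⟩

/-- The point of the chord `ac` above the abscissa `x`. -/
theorem Convex.chord_mem {s : Set (ℝ × ℝ)} (hs : Convex ℝ s) {a c : ℝ × ℝ} (ha : a ∈ s)
    (hc : c ∈ s) {x : ℝ} (hax : a.1 < x) (hxc : x < c.1) :
    (x, ((c.1 - x) * a.2 + (x - a.1) * c.2) / (c.1 - a.1)) ∈ s := by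
  have hac : 0 < c.1 - a.1 := by linarith
  have := hs ha hc (a := (c.1 - x) / (c.1 - a.1)) (b := (x - a.1) / (c.1 - a.1))
    (div_nonneg (by linarith) hac.le) (div_nonneg (by linarith) hac.le)
    (by field_simp; ring)
  convert this using 1
  ext
  · simp only [Prod.fst_add, Prod.smul_fst, smul_eq_mul]
    field_simp
    ring
  · simp only [Prod.snd_add, Prod.smul_snd, smul_eq_mul]
    field_simp

/-- The embedding of integer points into the real plane. -/
def realPoint (p : ℤ × ℤ) : ℝ × ℝ := ((p.1 : ℝ), (p.2 : ℝ))

theorem realPoint_injective : Function.Injective realPoint := by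
  intro p q h
  simpa [realPoint, Prod.ext_iff] using h

theorem cast_turn (a q c : ℤ × ℤ) : (turn a q c : ℝ) =
    ((q.1 : ℝ) - a.1) * (c.2 - q.2) - (q.2 - a.2) * (c.1 - q.1) := by
  simp [turn]

theorem inConvexPosition_of_forall_notMem {A : Finset (ℤ × ℤ)} {E : Set (ℝ × ℝ)}
    (hAE : ∀ p ∈ A, realPoint p ∈ E) (hE : ∀ x ∈ E, x ∉ convexHull ℝ (E \ {x})) :
    InConvexPosition A := by
  intro q hq a ha c hc a' ha' c' hc' h1 h2 h3 h4 h5 h6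
  refine hE _ (hAE q hq) ?_
  have hmem : ∀ p ∈ A, p.1 ≠ q.1 → realPoint p ∈ convexHull ℝ (E \ {realPoint q}) := by
    refine fun p hp hpq => subset_convexHull ℝ _ ⟨hAE p hp, fun h => hpq ?_⟩
    rw [realPoint_injective h]
  have h5' : (0 : ℝ) ≤ turn a q c := by exact_mod_cast h5
  have h6' : (turn a' q c' : ℝ) ≤ 0 := by exact_mod_cast h6
  rw [cast_turn] at h5' h6'
  have g1 : (a.1 : ℝ) < q.1 := by exact_mod_cast h1
  have g2 : (q.1 : ℝ) < c.1 := by exact_mod_cast h2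
  have g3 : (a'.1 : ℝ) < q.1 := by exact_mod_cast h3
  have g4 : (q.1 : ℝ) < c'.1 := by exact_mod_cast h4
  have hs := convex_convexHull ℝ (E \ {realPoint q})
  refine hs.mk_mem_of_mem_of_le
    (hs.chord_mem (hmem a' ha' h3.ne) (hmem c' hc' h4.ne') g3 g4)
    (hs.chord_mem (hmem a ha h1.ne) (hmem c hc h2.ne') g1 g2) ?_ ?_
  · simp only [realPoint]
    rw [div_le_iff₀ (by linarith)]
    linarith
  · simp only [realPoint]
    rw [le_div_iff₀ (by linarith)]
    linarith

theorem mainTheorem2 (t : ℕ) (ht : 0 < t) (k : ℕ) (P : Set (ℝ × ℝ))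
    (hP : IsConvexGon (toPlane (esSet t)) k P) : k ≤ t - 1 := by
  classical
  obtain ⟨⟨V, rfl⟩, hsub, rfl⟩ := hP
  have hE := convexIndependent_set_iff_notMem_convexHull_sdiff.1
    (convex_convexHull ℝ (V : Set (ℝ × ℝ))).convexIndependent_extremePoints
  generalize (convexHull ℝ (V : Set (ℝ × ℝ))).extremePoints ℝ = E at *
  let A := (esSet t).filter fun p => realPoint p ∈ E
  have hA : E = realPoint '' (A : Set (ℤ × ℤ)) := by
    ext x
    constructor
    · intro hx
      obtain ⟨p, hp, rfl⟩ := hsub hx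
      exact ⟨p, Finset.mem_coe.2 (Finset.mem_filter.2 ⟨hp, hx⟩), rfl⟩
    · rintro ⟨p, hp, rfl⟩
      exact (Finset.mem_filter.1 hp).2
  have hpos : InConvexPosition A :=
    inConvexPosition_of_forall_notMem (fun p hp => (Finset.mem_filter.1 hp).2) hE
  rw [hA, Set.ncard_image_of_injective _ realPoint_injective, Set.ncard_coe_finset]
  exact hpos.card_le (Finset.filter_subset _ _)
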